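/- **Theorem (Quantumly efficient evaluatability).** *Conventions.* $N$ ranges over the positive integers. A quantum algorithm is a program with classical control that manipulates finitely many stacks of bits, tosses coins, applies the gates $H$, $T$, CNOT to qubits (initially $|0\rangle$) and measures qubits; its running time is the number of elementary steps, and a time bound has to hold for all outcomes of positive probability. A classical randomized algorithm is such a program without gates and measurements. A real parameter $\epsilon\in(0,1)$ is given to an algorithm as the integer $\lceil 1/\epsilon\rceil$ in unary. Let $D:\mathbb N\to\mathbb N$ satisfy $D(N)=O(\mathrm{poly}(N))$; for each $N$ let $\mathcal D_N$ be any probability distribution on $\{0,1\}^N$, with support $\mathcal X_N$, and let $f_N:\{0,1\}^N\to\mathbb F_2^{D(N)}$. An algorithm $\mathcal A$ is a *HeurFBQP algorithm* for $\{(f_N,\mathcal D_N)\}_N$ if it is a quantum algorithm such that for all $N$ and all real $0<\mu,\nu<1$ it runs on every $x\in\mathcal X_N$ in time $O(\mathrm{poly}(N,1/\mu,1/\nu))$ and $$\Pr_{x\sim\mathcal D_N}\bigl[\Pr[\mathcal A(x,\mu,\nu)=f_N(x)]\ge 1-\nu\bigr]\ge 1-\mu .$$ $\{(f_N,\mathcal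 D_N)\}_N$ is in $\mathsf{HeurFBQP}$ if such an $\mathcal A$ exists; it is in $\mathsf{HeurFBPP/poly}$ if the same holds for some classical randomized algorithm that in addition receives an advice string of length $O(\mathrm{poly}(N,1/\mu,1/\nu))$ depending only on $N,\mu,\nu$. The function $f_N$ is *quantumly advantageous* under $\mathcal D_N$ if $\{(f_N,\mathcal D_N)\}_N\in\mathsf{HeurFBQP}\setminus\mathsf{HeurFBPP/poly}$. A family of classes $\mathcal H_N$ of functions $h:\{0,1\}^N\to\{0,1\}$, with a representation of its members by bit strings, is *quantumly efficiently evaluatable* under $\mathcal D_N$ if there is a quantum algorithm $\mathcal B$ such that for all $N$, all $0<\epsilon,\delta<1$ and every string $\sigma_h$ of length $O(\mathrm{poly}(N,1/\epsilon,1/\delta))$ representing a hypothesis $h\in\mathcal H_N$, $\mathcal B$ runs for all $x\in\mathcal X_N$ in time $O(\mathrm{poly}(N,1/\epsilon,1/\delta))$ and $$\Pr_{x\sim\mathcal D_N}\bigl[\Pr[\mathcal B(x,\sigma_h,\epsilon,\delta)=h(x)]\ge 1-\delta\bigr]\ge 1-\epsilon .$$ Let $\mathcal H_N=\{h_{\tilde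 s}:\tilde s\in\mathbb F_2^{D(N)}\}$ with $h_{\tilde s}(x)=f_N(x)\cdot\tilde s\in\mathbb F_2=\{0,1\}$, where $h_{\tilde s}$ is represented by the $D(N)$ bits of $\tilde s$. 1. If $f_N$ is quantumly advantageous under $\mathcal D_N$, then $\mathcal H_N$ is quantumly efficiently evaluatable under $\mathcal D_N$. 2. More precisely, for every HeurFBQP algorithm $\mathcal A$ for $\{(f_N,\mathcal D_N)\}_N$ (whether or not the problem is classically hard), there is a quantum algorithm $\mathcal B$ realising the procedure "on input $(x,\tilde s,\epsilon,\delta)$ run $\mathcal A$ on $x$ with $\mu=\epsilon$ and $\nu=\delta$ and output $\mathcal A(x)\cdot\tilde s$", i.e. for all $N$, all $0<\epsilon,\delta<1$, $x\in\mathcal X_N$ and $\tilde s\in\mathbb F_2^{D(N)}$ the output of $\mathcal B$ on $(x,\tilde s,\epsilon,\delta)$ has the distribution of the bit $\mathcal A(x,\epsilon,\delta)\cdot\tilde s$ (an output of $\mathcal A$ of a length other than $D(N)$ being truncated, or padded with zeros, to length $D(N)$), and this $\mathcal B$ evaluates $\mathcal H_N$ efficiently under $\mathcal D_N$ in the above sense.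 -/

import Mathlib

noncomputable section

namespace QML

open scoped ENNReal

/-! ### Machine model

A quantum algorithm is a finite program for a classical machine that controls a quantum memory.
The classical memory consists of stacks of bits, numbered by `ℕ` (a program mentions only finitely
many of them).  The quantum memory consists of qubits, numbered by `ℕ`, all initially `|0⟩`; the
qubit on which an instruction acts is addressed by the current height of a stack.  The gates are
Hadamard, `T` and CNOT, and qubits can be measured in the computational basis at any time. -/

/-- Programs. -/
inductive Prog : Type
  /-- do nothing -/
  | skip : Prog
  /-- push the bit `b` on stack `r` -/
  | push (r : ℕ) (b : Bool) : Prog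
  /-- remove the top bit of stack `r` (no effect on an empty stack) -/
  | pop (r : ℕ) : Prog
  /-- push a uniformly random bit on stack `r` -/
  | coin (r : ℕ) : Prog
  /-- Hadamard gate on the qubit whose number is the height of stack `r` -/
  | hadamard (r : ℕ) : Prog
  /-- `T = diag(1, e^{iπ/4})` gate on the qubit whose number is the height of stack `r` -/
  | tgate (r : ℕ) : Prog
  /-- CNOT gate; control and target are given by the heights of stacks `r` and `r'`
  (no effect if these are equal) -/
  | cnot (r r' : ℕ) : Prog
  /-- measure the qubit whose number is the height of stack `r`, push the result on stack `r'` -/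
  | measure (r r' : ℕ) : Prog
  /-- first `p`, then `q` -/
  | seq (p q : Prog) : Prog
  /-- run `p`, `q₀` or `q₁` according to whether stack `r` is empty, has top bit `0`,
  or has top bit `1` -/
  | branch (r : ℕ) (p q₀ q₁ : Prog) : Prog
  /-- while stack `r` is not empty, run `p` -/
  | loop (r : ℕ) (p : Prog) : Prog

/-- Classical randomized programs: those that never touch the quantum memory. -/
def Prog.IsClassical : Prog → Prop
  | .skip => True
  | .push _ _ => True
  | .pop _ => True
  | .coin _ => True
  | .hadamard _ => False
  | .tgate _ => False
  | .cnot _ _ => False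
  | .measure _ _ => False
  | .seq p q => p.IsClassical ∧ q.IsClassical
  | .branch _ p q₀ q₁ => p.IsClassical ∧ q₀.IsClassical ∧ q₁.IsClassical
  | .loop _ p => p.IsClassical

/-- (Unnormalised) state vectors of the quantum memory.  The computational basis vector labelled
by the finite set `S` has the qubits in `S` equal to `1` and all other qubits equal to `0`. -/
abbrev QState : Type := Finset ℕ →₀ ℂ

/-- Hadamard gate on qubit `i`. -/
def applyH (i : ℕ) (ψ : QState) : QState :=
  Finsupp.linearCombination ℂ
    (fun S : Finset ℕ => ((Real.sqrt 2 : ℝ) : ℂ)⁻¹ •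
      (Finsupp.single (S.erase i) (1 : ℂ) +
        Finsupp.single (insert i S) (if i ∈ S then (-1 : ℂ) else 1))) ψ

/-- `T` gate on qubit `i`. -/
def applyT (i : ℕ) (ψ : QState) : QState :=
  Finsupp.linearCombination ℂ
    (fun S : Finset ℕ => Finsupp.single S
      (if i ∈ S then Complex.exp (Complex.I * (Real.pi / 4 : ℝ)) else 1)) ψ

/-- CNOT gate with control `i` and target `j`. -/
def applyCNOT (i j : ℕ) (ψ : QState) : QState :=
  Finsupp.linearCombination ℂ
    (fun S : Finset ℕ => Finsupp.single
      (if i ∈ S ∧ i ≠ j then (if j ∈ S then S.erase j else insert j S) else S) (1 : ℂ)) ψ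

/-- Projection on the subspace where qubit `i` has the value `b`. -/
def project (i : ℕ) (b : Bool) (ψ : QState) : QState :=
  ψ.filter (fun S => decide (i ∈ S) = b)

/-- The squared norm of a state vector. -/
def weight (ψ : QState) : ℝ≥0∞ := ψ.sum fun _ a => ‖a‖ₑ ^ 2

/-- A configuration of one computation branch: the programs still to be run, the contents of the
stacks (top first), and the unnormalised state of the quantum memory, whose squared norm is the
probability of the branch. -/
structure Config : Type where
  todo : List Prog
  mem : ℕ → List Bool
  state : QState

/-- Push a bit on a stack. -/
def pushBit (m : ℕ → List Bool) (r : ℕ) (b : Bool) : ℕ → List Bool :=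
  Function.update m r (b :: m r)

/-- One step of computation.  A random bit and a measurement split a branch into two. -/
def step : Config → List Config
  | ⟨[], m, ψ⟩ => [⟨[], m, ψ⟩]
  | ⟨.skip :: k, m, ψ⟩ => [⟨k, m, ψ⟩]
  | ⟨.push r b :: k, m, ψ⟩ => [⟨k, pushBit m r b, ψ⟩]
  | ⟨.pop r :: k, m, ψ⟩ => [⟨k, Function.update m r (m r).tail, ψ⟩]
  | ⟨.coin r :: k, m, ψ⟩ =>
      [⟨k, pushBit m r false, ((Real.sqrt 2 : ℝ) : ℂ)⁻¹ • ψ⟩,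
       ⟨k, pushBit m r true, ((Real.sqrt 2 : ℝ) : ℂ)⁻¹ • ψ⟩]
  | ⟨.hadamard r :: k, m, ψ⟩ => [⟨k, m, applyH (m r).length ψ⟩]
  | ⟨.tgate r :: k, m, ψ⟩ => [⟨k, m, applyT (m r).length ψ⟩]
  | ⟨.cnot r r' :: k, m, ψ⟩ => [⟨k, m, applyCNOT (m r).length (m r').length ψ⟩]
  | ⟨.measure r r' :: k, m, ψ⟩ =>
      [⟨k, pushBit m r' false, project (m r).length false ψ⟩,
       ⟨k, pushBit m r' true, project (m r).length true ψ⟩]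
  | ⟨.seq p q :: k, m, ψ⟩ => [⟨p :: q :: k, m, ψ⟩]
  | ⟨.branch r p q₀ q₁ :: k, m, ψ⟩ =>
      match m r with
      | [] => [⟨p :: k, m, ψ⟩]
      | false :: _ => [⟨q₀ :: k, m, ψ⟩]
      | true :: _ => [⟨q₁ :: k, m, ψ⟩]
  | ⟨.loop r p :: k, m, ψ⟩ =>
      match m r with
      | [] => [⟨k, m, ψ⟩]
      | _ :: _ => [⟨p :: .loop r p :: k, m, ψ⟩]

/-- All computation branches after `t` steps from `c`. -/
def branches (c : Config) : ℕ → List Config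
  | 0 => [c]
  | t + 1 => (branches c t).flatMap step

/-- The input of an algorithm: a bit string `x`, the parameters `ε` and `δ` (given through the
integers `⌈1/ε⌉` and `⌈1/δ⌉` in unary), and a further bit string `a`, which is empty for algorithms
without advice.  They are on stacks `0`, `1`, `2`, `3`; all other stacks are empty. -/
def inputMem (x : List Bool) (ε δ : ℝ) (a : List Bool) : ℕ → List Bool
  | 0 => x
  | 1 => List.replicate ⌈1 / ε⌉₊ true
  | 2 => List.replicate ⌈1 / δ⌉₊ true
  | 3 => a
  | _ => []

/-- The initial configuration, with all qubits in state `|0⟩`. -/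
def start (A : Prog) (x : List Bool) (ε δ : ℝ) (a : List Bool) : Config :=
  ⟨[A], inputMem x ε δ a, Finsupp.single ∅ 1⟩

/-- The output is the content of stack `4` upon halting. -/
def Config.output (c : Config) : List Bool := c.mem 4

/-- The algorithm halts within `t` steps, whatever the results of measurements and coin tosses
(results of probability zero being disregarded). -/
def HaltsWithin (A : Prog) (x : List Bool) (ε δ : ℝ) (a : List Bool) (t : ℕ) : Prop :=
  ∀ c ∈ branches (start A x ε δ a) t, c.state = 0 ∨ c.todo = []

open Classical in
/-- The probability that the algorithm halts within `t` steps with an output in `E`. -/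
def probWithin (A : Prog) (x : List Bool) (ε δ : ℝ) (a : List Bool) (E : Set (List Bool))
    (t : ℕ) : ℝ≥0∞ :=
  ((branches (start A x ε δ a) t).map
    (fun c => if c.todo = [] ∧ c.output ∈ E then weight c.state else 0)).sum

/-- The probability that the algorithm halts with an output in `E`. -/
def outProb (A : Prog) (x : List Bool) (ε δ : ℝ) (a : List Bool) (E : Set (List Bool)) : ℝ≥0∞ :=
  ⨆ t : ℕ, probWithin A x ε δ a E t

/-! ### Complexity classes -/

/-- The value `p(N, 1/ε, 1/δ)` of a polynomial with natural coefficients. -/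
def polyVal (p : MvPolynomial (Fin 3) ℕ) (N : ℕ) (ε δ : ℝ) : ℝ :=
  MvPolynomial.aeval ![(N : ℝ), 1 / ε, 1 / δ] p

/-- The algorithm halts within `p(N, 1/ε, 1/δ)` steps. -/
def RunsInTime (A : Prog) (p : MvPolynomial (Fin 3) ℕ) (N : ℕ) (x : List Bool) (ε δ : ℝ)
    (a : List Bool) : Prop :=
  ∃ t : ℕ, (t : ℝ) ≤ polyVal p N ε δ ∧ HaltsWithin A x ε δ a t

/-- The bit string of a Boolean vector. -/
def bits {n : ℕ} (x : Fin n → Bool) : List Bool := List.ofFn x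

/-- The bit of an element of `𝔽₂`. -/
def toBit (z : ZMod 2) : Bool := decide (z = 1)

/-- The bit string of a vector over `𝔽₂`. -/
def vecBits {n : ℕ} (v : Fin n → ZMod 2) : List Bool := List.ofFn fun i => toBit (v i)

/-- A bit string read as a vector of `𝔽₂ⁿ` (inverse to `vecBits` on strings of length `n`;
other strings are truncated, or extended by zeros). -/
def readVec (n : ℕ) (l : List Bool) : Fin n → ZMod 2 :=
  fun i => if l.getD i false then 1 else 0

/-- `A` solves the distributional function problem `(f, 𝒟)` heuristically in polynomial time. -/
def SolvesHeuristically {D : ℕ → ℕ} (A : Prog)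
    (f : (N : ℕ) → (Fin N → Bool) → (Fin (D N) → ZMod 2))
    (𝒟 : (N : ℕ) → PMF (Fin N → Bool)) : Prop :=
  ∃ p : MvPolynomial (Fin 3) ℕ, ∀ N : ℕ, 1 ≤ N → ∀ μ ν : ℝ, 0 < μ → μ < 1 → 0 < ν → ν < 1 →
    (∀ x ∈ (𝒟 N).support, RunsInTime A p N (bits x) μ ν []) ∧
    ENNReal.ofReal (1 - μ) ≤ (𝒟 N).toOuterMeasure
      {x | ENNReal.ofReal (1 - ν) ≤ outProb A (bits x) μ ν [] {vecBits (f N x)}}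

/-- The class `HeurFBQP`. -/
def InHeurFBQP {D : ℕ → ℕ} (f : (N : ℕ) → (Fin N → Bool) → (Fin (D N) → ZMod 2))
    (𝒟 : (N : ℕ) → PMF (Fin N → Bool)) : Prop :=
  ∃ A : Prog, SolvesHeuristically A f 𝒟

/-- The class `HeurFBPP/poly`; the advice string may depend on `N`, `μ`, `ν`, not on `x`. -/
def InHeurFBPPPoly {D : ℕ → ℕ} (f : (N : ℕ) → (Fin N → Bool) → (Fin (D N) → ZMod 2))
    (𝒟 : (N : ℕ) → PMF (Fin N → Bool)) : Prop :=
  ∃ A : Prog, A.IsClassical ∧ ∃ p : MvPolynomial (Fin 3) ℕ,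
    ∀ N : ℕ, 1 ≤ N → ∀ μ ν : ℝ, 0 < μ → μ < 1 → 0 < ν → ν < 1 →
      ∃ α : List Bool, (α.length : ℝ) ≤ polyVal p N μ ν ∧
        (∀ x ∈ (𝒟 N).support, RunsInTime A p N (bits x) μ ν α) ∧
        ENNReal.ofReal (1 - μ) ≤ (𝒟 N).toOuterMeasure
          {x | ENNReal.ofReal (1 - ν) ≤ outProb A (bits x) μ ν α {vecBits (f N x)}}

/-- `f` is quantumly advantageous under `𝒟`. -/
def QuantumlyAdvantageous {D : ℕ → ℕ} (f : (N : ℕ) → (Fin N → Bool) → (Fin (D N) → ZMod 2))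
    (𝒟 : (N : ℕ) → PMF (Fin N → Bool)) : Prop :=
  InHeurFBQP f 𝒟 ∧ ¬ InHeurFBPPPoly f 𝒟

/-! ### Hypothesis classes and their evaluation -/

/-- A family of hypothesis classes together with a representation of hypotheses by bit strings. -/
structure HypothesisClass : Type where
  /-- the hypotheses on inputs of `N` bits -/
  hyps : (N : ℕ) → Set ((Fin N → Bool) → ZMod 2)
  /-- `Represents N σ h`: the bit string `σ` represents `h` -/
  Represents : (N : ℕ) → List Bool → ((Fin N → Bool) → ZMod 2) → Prop
  mem_of_represents : ∀ N σ h, Represents N σ h → h ∈ hyps N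
  exists_represents : ∀ N, ∀ h ∈ hyps N, ∃ σ, Represents N σ h
  represents_unique : ∀ N σ h h', Represents N σ h → Represents N σ h' → h = h'

/-- `B`, given `x`, a representation `σ` of a hypothesis, `ε` and `δ`, evaluates the hypotheses of
`H` efficiently under `𝒟`.  The input space is the support of `𝒟 N`.  The algorithm does not depend
on the polynomial bound `q` on the length of representations; its running time may. -/
def EfficientlyEvaluates (B : Prog) (H : HypothesisClass)
    (𝒟 : (N : ℕ) → PMF (Fin N → Bool)) : Prop :=
  ∀ q : MvPolynomial (Fin 3) ℕ, ∃ p : MvPolynomial (Fin 3) ℕ,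
    ∀ N : ℕ, 1 ≤ N → ∀ ε δ : ℝ, 0 < ε → ε < 1 → 0 < δ → δ < 1 →
      ∀ (σ : List Bool) (h : (Fin N → Bool) → ZMod 2), H.Represents N σ h →
        (σ.length : ℝ) ≤ polyVal q N ε δ →
        (∀ x ∈ (𝒟 N).support, RunsInTime B p N (bits x) ε δ σ) ∧
        ENNReal.ofReal (1 - ε) ≤ (𝒟 N).toOuterMeasure
          {x | ENNReal.ofReal (1 - δ) ≤ outProb B (bits x) ε δ σ {[toBit (h x)]}}

/-- `H` is quantumly efficiently evaluatable under `𝒟`. -/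
def QuantumlyEfficientlyEvaluatable (H : HypothesisClass)
    (𝒟 : (N : ℕ) → PMF (Fin N → Bool)) : Prop :=
  ∃ B : Prog, EfficientlyEvaluates B H 𝒟

/-- The hypothesis `h_s(x) = f_N(x) · s`. -/
def linearHyp {D : ℕ → ℕ} (f : (N : ℕ) → (Fin N → Bool) → (Fin (D N) → ZMod 2)) (N : ℕ)
    (s : Fin (D N) → ZMod 2) : (Fin N → Bool) → ZMod 2 :=
  fun x => dotProduct (f N x) s

theorem vecBits_injective {n : ℕ} : Function.Injective (vecBits (n := n)) := by
  intro v w h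
  have h' := List.ofFn_injective h
  funext i
  have hi := congrFun h' i
  have key : ∀ a b : ZMod 2, toBit a = toBit b → a = b := by decide
  exact key _ _ hi

/-- The class `{h_s : s ∈ 𝔽₂^D}`, where `h_s` is represented by the `D` bits of `s`. -/
def linearClass {D : ℕ → ℕ} (f : (N : ℕ) → (Fin N → Bool) → (Fin (D N) → ZMod 2)) :
    HypothesisClass where
  hyps N := Set.range (linearHyp f N)
  Represents N σ h := ∃ s : Fin (D N) → ZMod 2, σ = vecBits s ∧ h = linearHyp f N s
  mem_of_represents := by
    rintro N σ h ⟨s, -, rfl⟩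
    exact ⟨s, rfl⟩
  exists_represents := by
    rintro N h ⟨s, rfl⟩
    exact ⟨_, s, rfl, rfl⟩
  represents_unique := by
    rintro N σ h h' ⟨s, rfl, rfl⟩ ⟨s', hs, rfl⟩
    rw [vecBits_injective hs]

/-- `B` realises the evaluation procedure built on `A`: on input `(x, s, ε, δ)`, run `A` on `x` with
parameters `μ = ε` and `ν = δ`, and output the bit `A(x) · s`.  That is, the output of `B` has the
distribution of `A(x) · s`. -/
def RealisesEvaluation {D : ℕ → ℕ} (B A : Prog) (𝒟 : (N : ℕ) → PMF (Fin N → Bool)) : Prop :=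
  ∀ N : ℕ, 1 ≤ N → ∀ ε δ : ℝ, 0 < ε → ε < 1 → 0 < δ → δ < 1 →
    ∀ x ∈ (𝒟 N).support, ∀ (s : Fin (D N) → ZMod 2) (E : Set (List Bool)),
      outProb B (bits x) ε δ (vecBits s) E =
        outProb A (bits x) ε δ [] {y | [toBit (dotProduct (readVec (D N) y) s)] ∈ E}

end QML

end

namespace QML

open scoped ENNReal

/-! ### Branches, halting and halting mass -/

/-! The bit `A(x)·s` is a deterministic function of the output of `A`, so `B` can run `A` unchanged
between two deterministic classical phases. The first phase moves `s` from the advice stack to a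
stack that `A` never mentions. `A` then sees exactly its own input with empty advice. The last phase
replaces the output `y` by the single bit `y·s`. The output distribution of `B` is thus the image of
that of `A` under `y ↦ y·s`. Whenever `A` outputs `f_N(x)`, `B` outputs `f_N(x)·s = h_s(x)`, so
every good `x` for `A` in the support is good for `B` with the same parameters. Classical hardness
plays no role.

Two facts need care. A finite program mentions finitely many stacks, so work stacks beyond its reach
exist, and a run of `A` in the larger memory matches the original step by step (`step_embed`).
Branches of `A` halt at different times, and branches of weight zero need not halt at all.
`haltsFrom_haltMass_embed` handles both: halted branches idle, and zero branches stay zero and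
contribute no mass. The time is linear in `|s|` and in the running time `t` of `A`, because an
output written in `t` steps has at most `t` bits (`length_le_of_mem_step`). `evalProg_spec`
assembles these facts. -/

theorem branches_add (c : Config) (s t : ℕ) :
    branches c (s + t) = (branches c s).flatMap fun c' => branches c' t := by
  induction t with
  | zero => simp [branches]
  | succ t ih => rw [← add_assoc, branches, ih, List.flatMap_assoc]; rfl

/-- Splitting off the first step, not the last, lets inductions on time vary the starting
configuration. -/
theorem branches_succ (c : Config) (t : ℕ) :
    branches c (t + 1) = (step c).flatMap fun c' => branches c' t := by
  rw [add_comm, branches_add]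
  simp [branches]

theorem branches_of_todo_nil (m : ℕ → List Bool) (ψ : QState) (t : ℕ) :
    branches ⟨[], m, ψ⟩ t = [⟨[], m, ψ⟩] := by
  induction t with
  | zero => rfl
  | succ t ih => rw [branches, ih]; simp [step]

/-- All branches of nonzero weight have halted after `t` steps. -/
def HaltsFrom (c : Config) (t : ℕ) : Prop :=
  ∀ c' ∈ branches c t, c'.state = 0 ∨ c'.todo = []

open Classical in
/-- The total weight of the branches that have halted after `t` steps with output in `E`. -/
noncomputable def haltMass (E : Set (List Bool)) (c : Config) (t : ℕ) : ℝ≥0∞ :=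
  ((branches c t).map (fun c => if c.todo = [] ∧ c.output ∈ E then weight c.state else 0)).sum

open Classical in
theorem haltMass_of_todo_nil (E : Set (List Bool)) (m : ℕ → List Bool) (ψ : QState) (t : ℕ) :
    haltMass E ⟨[], m, ψ⟩ t = if m 4 ∈ E then weight ψ else 0 := by
  rw [haltMass, branches_of_todo_nil]
  by_cases h : m 4 ∈ E <;> simp [Config.output, h]

theorem haltsFrom_succ (c : Config) (t : ℕ) :
    HaltsFrom c (t + 1) ↔ ∀ c' ∈ step c, HaltsFrom c' t := by
  simp only [HaltsFrom, branches_succ, List.mem_flatMap]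
  exact ⟨fun h c' hc' d hd => h d ⟨c', hc', hd⟩, fun h d ⟨c', hc', hd⟩ => h c' hc' d hd⟩

theorem sum_flatMap_eq {α β : Type*} (l : List α) (g : α → List β) (F : β → ℝ≥0∞) :
    ((l.flatMap g).map F).sum = (l.map fun a => ((g a).map F).sum).sum := by
  induction l with
  | nil => simp
  | cons a l ih => simp [ih]

theorem haltMass_succ (E : Set (List Bool)) (c : Config) (t : ℕ) :
    haltMass E c (t + 1) = ((step c).map fun c' => haltMass E c' t).sum := by
  rw [haltMass, branches_succ, sum_flatMap_eq]
  rfl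

/-- A halted configuration is a fixed point of `step`, so its contribution persists. -/
theorem haltMass_mono (E : Set (List Bool)) (c : Config) : Monotone (haltMass E c) := by
  classical
  refine monotone_nat_of_le_succ fun t => ?_
  rw [haltMass, haltMass, branches, sum_flatMap_eq]
  refine List.sum_le_sum fun d _ => ?_
  obtain ⟨k, m, ψ⟩ := d
  split_ifs with h
  · obtain ⟨h1, h2⟩ := h
    obtain rfl : k = [] := h1
    have h2' : (⟨[], m, ψ⟩ : Config).output ∈ E := h2
    simp [step, h2']
  · exact zero_le

theorem haltMass_subset {E F : Set (List Bool)} (h : E ⊆ F) (c : Config) (t : ℕ) :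
    haltMass E c t ≤ haltMass F c t := by
  classical
  refine List.sum_le_sum fun d _ => ?_
  split_ifs with h1 h2 h2
  · exact le_rfl
  · exact absurd ⟨h1.1, h h1.2⟩ h2
  · exact zero_le
  · exact le_rfl

theorem weight_zero : weight 0 = 0 := by simp [weight]

/-- Gates, projections and scalings are all linear. Branches of probability zero may run forever,
and this is what allows them to be ignored. -/
theorem state_eq_zero_of_mem_step {c d : Config} (hc : c.state = 0) (hd : d ∈ step c) :
    d.state = 0 := by
  obtain ⟨k, m, ψ⟩ := c
  obtain rfl : ψ = 0 := hc
  rcases k with _ | ⟨p, k⟩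
  · simp [step] at hd
    simp [hd]
  cases p with
  | branch r p q₀ q₁ => rcases h : m r with _ | ⟨_ | _, l⟩ <;> simp [step, h] at hd <;> simp [hd]
  | loop r p => rcases h : m r with _ | ⟨b, l⟩ <;> simp [step, h] at hd <;> simp [hd]
  | coin | measure =>
    simp only [step, List.mem_cons, List.not_mem_nil, or_false] at hd
    rcases hd with rfl | rfl <;> first | exact smul_zero _ | exact Finsupp.filter_zero _
  | _ =>
    simp [step] at hd
    simp [hd, applyH, applyT, applyCNOT]

theorem state_eq_zero_of_mem_branches {c d : Config} {t : ℕ} (hc : c.state = 0)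
    (hd : d ∈ branches c t) : d.state = 0 := by
  induction t generalizing d with
  | zero =>
    obtain rfl : d = c := by simpa [branches] using hd
    exact hc
  | succ t ih =>
    obtain ⟨e, he, hde⟩ := List.mem_flatMap.1 hd
    exact state_eq_zero_of_mem_step (ih he) hde

theorem haltsFrom_of_state_eq_zero {c : Config} (hc : c.state = 0) (t : ℕ) : HaltsFrom c t :=
  fun _ hd => Or.inl (state_eq_zero_of_mem_branches hc hd)

theorem haltMass_of_state_eq_zero (E : Set (List Bool)) {c : Config} (hc : c.state = 0) (t : ℕ) :
    haltMass E c t = 0 := by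
  classical
  refine List.sum_eq_zero fun x hx => ?_
  obtain ⟨d, hd, rfl⟩ := List.mem_map.1 hx
  simp [state_eq_zero_of_mem_branches hc hd, weight_zero]

theorem HaltsFrom.mono {c : Config} {s t : ℕ} (h : HaltsFrom c s) (hst : s ≤ t) :
    HaltsFrom c t := by
  obtain ⟨n, rfl⟩ := Nat.exists_eq_add_of_le hst
  intro d hd
  rw [branches_add] at hd
  obtain ⟨⟨k, m, ψ⟩, he, hde⟩ := List.mem_flatMap.1 hd
  rcases h _ he with h0 | h0
  · exact Or.inl (state_eq_zero_of_mem_branches h0 hde)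
  · obtain rfl : k = [] := h0
    rw [branches_of_todo_nil] at hde
    obtain rfl := List.mem_singleton.1 hde
    exact Or.inr rfl

/-! ### Deterministic executions -/

/-- The program `p` deterministically changes the memory from `m` to `m'` in `n` steps and does not
touch the qubits. -/
def Exec (p : Prog) (m m' : ℕ → List Bool) (n : ℕ) : Prop :=
  ∀ k ψ, branches ⟨p :: k, m, ψ⟩ n = [⟨k, m', ψ⟩]

theorem Exec.skip (m : ℕ → List Bool) : Exec .skip m m 1 := fun _ _ => rfl

theorem Exec.push (m : ℕ → List Bool) (r : ℕ) (b : Bool) :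
    Exec (.push r b) m (pushBit m r b) 1 := fun _ _ => rfl

theorem Exec.pop (m : ℕ → List Bool) (r : ℕ) :
    Exec (.pop r) m (Function.update m r (m r).tail) 1 := fun _ _ => rfl

theorem Exec.seq {p q : Prog} {m m' m'' : ℕ → List Bool} {i j : ℕ} (hp : Exec p m m' i)
    (hq : Exec q m' m'' j) : Exec (.seq p q) m m'' (i + j + 1) := fun k ψ => by
  rw [branches_succ]
  simp [step, branches_add, hp _ _, hq _ _]

theorem Exec.branch_nil {r : ℕ} {p q₀ q₁ : Prog} {m m' : ℕ → List Bool} {n : ℕ} (hm : m r = [])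
    (h : Exec p m m' n) : Exec (.branch r p q₀ q₁) m m' (n + 1) := fun k ψ => by
  rw [branches_succ]
  simp [step, hm, h _ _]

theorem Exec.branch_false {r : ℕ} {p q₀ q₁ : Prog} {m m' : ℕ → List Bool} {n : ℕ}
    {l : List Bool} (hm : m r = false :: l) (h : Exec q₀ m m' n) :
    Exec (.branch r p q₀ q₁) m m' (n + 1) := fun k ψ => by
  rw [branches_succ]
  simp [step, hm, h _ _]

theorem Exec.branch_true {r : ℕ} {p q₀ q₁ : Prog} {m m' : ℕ → List Bool} {n : ℕ}
    {l : List Bool} (hm : m r = true :: l) (h : Exec q₁ m m' n) :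
    Exec (.branch r p q₀ q₁) m m' (n + 1) := fun k ψ => by
  rw [branches_succ]
  simp [step, hm, h _ _]

theorem Exec.loop_nil {r : ℕ} {p : Prog} {m : ℕ → List Bool} (hm : m r = []) :
    Exec (.loop r p) m m 1 := fun k ψ => by
  rw [branches_succ]
  simp [step, hm, branches]

theorem Exec.loop_cons {r : ℕ} {p : Prog} {m m' m'' : ℕ → List Bool} {i j : ℕ} {b : Bool}
    {l : List Bool} (hm : m r = b :: l) (hp : Exec p m m' i) (hl : Exec (.loop r p) m' m'' j) :
    Exec (.loop r p) m m'' (i + j + 1) := fun k ψ => by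
  rw [branches_succ]
  simp [step, hm, branches_add, hp _ _, hl _ _]

theorem Exec.haltMass_eq {p : Prog} {m m' : ℕ → List Bool} {n : ℕ} (h : Exec p m m' n)
    (E : Set (List Bool)) (k : List Prog) (ψ : QState) (t : ℕ) :
    haltMass E ⟨p :: k, m, ψ⟩ (n + t) = haltMass E ⟨k, m', ψ⟩ t := by
  rw [haltMass, branches_add, h k ψ, haltMass]
  simp

theorem Exec.haltsFrom {p : Prog} {m m' : ℕ → List Bool} {n : ℕ} (h : Exec p m m' n)
    {k : List Prog} {ψ : QState} {t : ℕ} (ht : HaltsFrom ⟨k, m', ψ⟩ t) :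
    HaltsFrom ⟨p :: k, m, ψ⟩ (n + t) := by
  rw [HaltsFrom, branches_add, h k ψ]
  simpa [HaltsFrom] using ht

/-! ### The programs around the given algorithm -/

/-- Move the content of stack `a` to stack `b`, reversing it. -/
def moveProg (a b : ℕ) : Prog :=
  .loop a (.seq (.branch a .skip (.push b false) (.push b true)) (.pop a))

/-- Each bit costs five steps: the loop test, the sequencing, the branch, the push and the pop. The
final `1` is the test that finds the stack empty. -/
theorem exec_moveProg {a b : ℕ} (hab : a ≠ b) (l : List Bool) (m : ℕ → List Bool) (hm : m a = l) :
    ∃ m', Exec (moveProg a b) m m' (5 * l.length + 1) ∧ m' a = [] ∧ m' b = l.reverse ++ m b ∧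
      ∀ r, r ≠ a → r ≠ b → m' r = m r := by
  induction l generalizing m with
  | nil => exact ⟨m, Exec.loop_nil hm, hm, by simp, fun _ _ _ => rfl⟩
  | cons c l ih =>
    have hbody : Exec (.seq (.branch a .skip (.push b false) (.push b true)) (.pop a)) m
        (Function.update (pushBit m b c) a ((pushBit m b c) a).tail) 4 := by
      refine Exec.seq (i := 2) (j := 1) ?_ (Exec.pop _ _)
      cases c
      · exact Exec.branch_false hm (Exec.push _ _ _)
      · exact Exec.branch_true hm (Exec.push _ _ _)
    obtain ⟨m', h1, h2, h3, h4⟩ := ih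
      (Function.update (pushBit m b c) a ((pushBit m b c) a).tail) (by simp [pushBit, hab, hm])
    refine ⟨m', ?_, h2, ?_, fun r ha hb => ?_⟩
    · rw [show 5 * (c :: l).length + 1 = 4 + (5 * l.length + 1) + 1 by
        rw [List.length_cons]; ring]
      exact Exec.loop_cons hm hbody h1
    · simp [h3, pushBit, hab.symm]
    · simp [h4 r ha hb, pushBit, ha, hb]

/-- Empty stack `a`. -/
def clearProg (a : ℕ) : Prog := .loop a (.pop a)

theorem exec_clearProg (a : ℕ) (l : List Bool) (m : ℕ → List Bool) (hm : m a = l) :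
    ∃ m', Exec (clearProg a) m m' (2 * l.length + 1) ∧ m' a = [] ∧
      ∀ r, r ≠ a → m' r = m r := by
  induction l generalizing m with
  | nil => exact ⟨m, Exec.loop_nil hm, hm, fun _ _ => rfl⟩
  | cons c l ih =>
    obtain ⟨m', h1, h2, h3⟩ := ih (Function.update m a (m a).tail) (by simp [hm])
    refine ⟨m', ?_, h2, fun r hr => by simp [h3 r hr, hr]⟩
    rw [show 2 * (c :: l).length + 1 = 1 + (2 * l.length + 1) + 1 by rw [List.length_cons]; ring]
    exact Exec.loop_cons hm (Exec.pop m a) h1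

/-- The inner product mod 2 of two bit strings, the first being truncated or padded with zeros to
the length of the second. -/
def dotBits : List Bool → List Bool → Bool
  | _, [] => false
  | y, b :: s => xor (b && y.headD false) (dotBits y.tail s)

theorem toBit_add (a b : ZMod 2) : toBit (a + b) = xor (toBit a) (toBit b) := by
  revert a b; decide

theorem toBit_mul (a b : ZMod 2) : toBit (a * b) = (toBit a && toBit b) := by
  revert a b; decide

theorem toBit_ite (b : Bool) : toBit (if b then 1 else 0) = b := by
  revert b; decide

/-- Links the recursion carried out by the machine to the inner product over `𝔽₂`. The default
`false` in `headD` and `getD` is the same padding by zeros. -/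
theorem dotBits_vecBits {n : ℕ} (s : Fin n → ZMod 2) (y : List Bool) :
    dotBits y (vecBits s) = toBit (dotProduct (readVec n y) s) := by
  induction n generalizing y with
  | zero => simp [vecBits, dotBits, toBit]
  | succ n ih =>
    have h : vecBits s = toBit (s 0) :: vecBits (fun i => s i.succ) := by simp [vecBits]
    have hdot : dotProduct (readVec (n + 1) y) s = readVec (n + 1) y 0 * s 0 +
        dotProduct (fun i : Fin n => readVec (n + 1) y i.succ) (fun i => s i.succ) :=
      Fin.sum_univ_succ _
    rw [h, dotBits, ih, hdot, toBit_add, toBit_mul, Bool.and_comm]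
    have h0 : toBit (readVec (n + 1) y 0) = y.headD false := by
      rw [readVec, toBit_ite]
      cases y <;> simp
    have h1 : ∀ i : Fin n, readVec (n + 1) y i.succ = readVec n y.tail i := fun i => by
      cases y <;> simp [readVec]
    simp only [h0, h1]

theorem readVec_vecBits {n : ℕ} (v : Fin n → ZMod 2) : readVec n (vecBits v) = v := by
  funext i
  have key : ∀ a : ZMod 2, (if toBit a then (1 : ZMod 2) else 0) = a := by decide
  simp [readVec, vecBits, key]

/-- The content of a stack that stands for the bit `b`: empty for `0`, one bit for `1`. -/
def flag (b : Bool) : List Bool := if b then [true] else []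

/-- Flip the bit represented by `flag` on stack `a`. -/
def toggleProg (a : ℕ) : Prog := .branch a (.push a true) .skip (.pop a)

theorem exec_toggleProg (a : ℕ) (b : Bool) (m : ℕ → List Bool) (hm : m a = flag b) :
    Exec (toggleProg a) m (Function.update m a (flag !b)) 2 := by
  cases b
  · have h := Exec.branch_nil (q₀ := .skip) (q₁ := .pop a) hm (Exec.push m a true)
    have hm' : m a = [] := hm
    simpa [toggleProg, pushBit, hm', flag] using h
  · have h := Exec.branch_true (p := .push a true) (q₀ := .skip) hm (Exec.pop m a)
    have hm' : m a = [true] := hm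
    simpa [toggleProg, hm', flag] using h

/-- Remove the top bits of stacks `i` and `4`, and add their product to the flag on `a`. -/
def dotStep (a i : ℕ) : Prog :=
  .seq (.branch i .skip .skip (.branch 4 .skip .skip (toggleProg a))) (.seq (.pop i) (.pop 4))

/-- A string on stack `4` that is too short is padded with zeros automatically: an empty stack leads
to `skip` in the branch, and popping it has no effect. -/
theorem exec_dotStep {a i : ℕ} (hai : a ≠ i) (ha : 4 < a) (hi : 4 < i) {acc b : Bool}
    {s : List Bool} {m : ℕ → List Bool} (hma : m a = flag acc) (hmi : m i = b :: s) :
    ∃ n ≤ 8, ∃ m', Exec (dotStep a i) m m' n ∧ m' a = flag (xor acc (b && (m 4).headD false)) ∧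
      m' i = s ∧ m' 4 = (m 4).tail := by
  -- At most two branches and a toggle of two steps. The two pops and the two sequencings then bring
  -- the total to 8.
  have h1 : ∃ n ≤ 4, Exec (.branch i .skip .skip (.branch 4 .skip .skip (toggleProg a))) m
      (Function.update m a (flag (xor acc (b && (m 4).headD false)))) n := by
    cases b
    · refine ⟨2, by norm_num, ?_⟩
      have h := Exec.branch_false (p := .skip) (q₁ := .branch 4 .skip .skip (toggleProg a)) hmi
        (Exec.skip m)
      simpa [← hma] using h
    · cases hm4 : m 4 with
      | nil =>
        refine ⟨3, by norm_num, ?_⟩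
        have h := Exec.branch_true (p := .skip) (q₀ := .skip) hmi (Exec.branch_nil (q₀ := .skip)
          (q₁ := toggleProg a) hm4 (Exec.skip m))
        simpa [← hma] using h
      | cons c y =>
        cases c
        · refine ⟨3, by norm_num, ?_⟩
          have h := Exec.branch_true (p := .skip) (q₀ := .skip) hmi (Exec.branch_false (p := .skip)
            (q₁ := toggleProg a) hm4 (Exec.skip m))
          simpa [← hma] using h
        · refine ⟨4, le_rfl, ?_⟩
          have h := Exec.branch_true (p := .skip) (q₀ := .skip) hmi (Exec.branch_true (p := .skip)
            (q₀ := .skip) hm4 (exec_toggleProg a acc m hma))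
          simpa using h
  obtain ⟨n, hn, h1⟩ := h1
  refine ⟨_, ?_, _, h1.seq ((Exec.pop _ i).seq (Exec.pop _ 4)), ?_, ?_, ?_⟩
  · omega
  · simp [hai, ha.ne']
  · simp [hai.symm, hi.ne', hmi]
  · simp [ha.ne, hi.ne]

theorem exec_dotLoop {a i : ℕ} (hai : a ≠ i) (ha : 4 < a) (hi : 4 < i) (s : List Bool) (acc : Bool)
    (m : ℕ → List Bool) (hma : m a = flag acc) (hmi : m i = s) :
    ∃ n ≤ 9 * s.length + 1, ∃ m', Exec (.loop i (dotStep a i)) m m' n ∧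
      m' a = flag (xor acc (dotBits (m 4) s)) ∧ (m' 4).length ≤ (m 4).length := by
  induction s generalizing acc m with
  | nil => exact ⟨1, by simp, m, Exec.loop_nil hmi, by simp [hma, dotBits], le_rfl⟩
  | cons b s ih =>
    obtain ⟨n₁, hn₁, m₁, h₁, ha₁, hi₁, h4₁⟩ := exec_dotStep hai ha hi hma hmi
    obtain ⟨n₂, hn₂, m₂, h₂, ha₂, h4₂⟩ := ih _ m₁ ha₁ hi₁
    refine ⟨_, ?_, m₂, Exec.loop_cons hmi h₁ h₂, ?_, ?_⟩
    · simp only [List.length_cons]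
      omega
    · rw [ha₂, h4₁, dotBits, Bool.xor_assoc]
    · rw [h4₁, List.length_tail] at h4₂
      omega

/-- Replace the content of stack `4` by its inner product with the content of stack `i`, using the
empty stack `a` as work space. -/
def dotProg (a i : ℕ) : Prog :=
  .seq (.loop i (dotStep a i))
    (.seq (clearProg 4) (.branch a (.push 4 false) .skip (.push 4 true)))

/-- The result is kept as a flag on `a` so that the rest of stack `4`, the part of an overlong
output to be truncated, can be erased before the answer is written there. -/
theorem exec_dotProg {a i : ℕ} (hai : a ≠ i) (ha : 4 < a) (hi : 4 < i) {m : ℕ → List Bool}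
    (hma : m a = []) :
    ∃ n ≤ 9 * (m i).length + 2 * (m 4).length + 6, ∃ m', Exec (dotProg a i) m m' n ∧
      m' 4 = [dotBits (m 4) (m i)] := by
  obtain ⟨n₁, hn₁, m₁, h₁, ha₁, h4₁⟩ := exec_dotLoop hai ha hi (m i) false m hma rfl
  obtain ⟨m₂, h₂, h4₂, ho₂⟩ := exec_clearProg 4 (m₁ 4) m₁ rfl
  have ha₂ : m₂ a = flag (dotBits (m 4) (m i)) := by
    rw [ho₂ a ha.ne', ha₁, Bool.false_xor]
  have h₃ : Exec (.branch a (.push 4 false) .skip (.push 4 true)) m₂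
      (pushBit m₂ 4 (dotBits (m 4) (m i))) 2 := by
    cases hd : dotBits (m 4) (m i)
    · rw [hd] at ha₂
      exact Exec.branch_nil ha₂ (Exec.push _ _ _)
    · rw [hd] at ha₂
      exact Exec.branch_true ha₂ (Exec.push _ _ _)
  refine ⟨_, ?_, _, h₁.seq (h₂.seq h₃), ?_⟩
  · omega
  · simp [pushBit, h4₂]

/-! ### Running an algorithm inside a larger one -/

/-- All stacks mentioned in the program have numbers less than `R`. -/
def Prog.StacksBelow (R : ℕ) : Prog → Prop
  | .skip => True
  | .push r _ => r < R
  | .pop r => r < R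
  | .coin r => r < R
  | .hadamard r => r < R
  | .tgate r => r < R
  | .cnot r r' => r < R ∧ r' < R
  | .measure r r' => r < R ∧ r' < R
  | .seq p q => p.StacksBelow R ∧ q.StacksBelow R
  | .branch r p q₀ q₁ => r < R ∧ p.StacksBelow R ∧ q₀.StacksBelow R ∧ q₁.StacksBelow R
  | .loop r p => r < R ∧ p.StacksBelow R

theorem Prog.StacksBelow.mono {R S : ℕ} (h : R ≤ S) {p : Prog} (hp : p.StacksBelow R) :
    p.StacksBelow S := by
  induction p <;> simp only [Prog.StacksBelow] at hp ⊢ <;> grind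

theorem Prog.exists_stacksBelow (p : Prog) : ∃ R, p.StacksBelow R := by
  induction p with
  | skip => exact ⟨0, trivial⟩
  | push r | pop r | coin r | hadamard r | tgate r => exact ⟨r + 1, Nat.lt_succ_self r⟩
  | cnot r r' | measure r r' =>
    exact ⟨r + r' + 1, by simp only [Prog.StacksBelow]; omega⟩
  | seq p q hp hq =>
    obtain ⟨R, hR⟩ := hp
    obtain ⟨S, hS⟩ := hq
    exact ⟨R + S, hR.mono (by omega), hS.mono (by omega)⟩
  | branch r p q₀ q₁ hp h₀ h₁ =>
    obtain ⟨R, hR⟩ := hp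
    obtain ⟨S, hS⟩ := h₀
    obtain ⟨T, hT⟩ := h₁
    exact ⟨r + 1 + R + S + T, by omega, hR.mono (by omega), hS.mono (by omega), hT.mono (by omega)⟩
  | loop r p hp =>
    obtain ⟨R, hR⟩ := hp
    exact ⟨r + 1 + R, by omega, hR.mono (by omega)⟩

/-- The memory with stacks below `R` as in `m` and the others as in `m₀`. -/
def mergeMem (R : ℕ) (m₀ m : ℕ → List Bool) : ℕ → List Bool := fun r => if r < R then m r else m₀ r

theorem mergeMem_of_lt {R r : ℕ} (h : r < R) (m₀ m : ℕ → List Bool) : mergeMem R m₀ m r = m r :=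
  if_pos h

theorem mergeMem_update {R r : ℕ} (h : r < R) (m₀ m : ℕ → List Bool) (l : List Bool) :
    mergeMem R m₀ (Function.update m r l) = Function.update (mergeMem R m₀ m) r l := by
  funext i
  by_cases hi : i = r
  · subst hi
    simp [mergeMem, h]
  · simp [mergeMem, hi]

theorem mergeMem_pushBit {R r : ℕ} (h : r < R) (m₀ m : ℕ → List Bool) (b : Bool) :
    mergeMem R m₀ (pushBit m r b) = pushBit (mergeMem R m₀ m) r b := by
  rw [pushBit, mergeMem_update h, pushBit, mergeMem_of_lt h]

/-- A configuration inside a larger memory, with a program `q` still to be run afterwards. -/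
def Config.embed (R : ℕ) (m₀ : ℕ → List Bool) (q : Prog) (c : Config) : Config :=
  ⟨c.todo ++ [q], mergeMem R m₀ c.mem, c.state⟩

/-- A step inspects only the stacks named by the instruction on top. The list `todo` must be
nonempty, since a halted configuration idles while its embedding starts on `q`. -/
theorem step_embed {R : ℕ} (m₀ : ℕ → List Bool) (q : Prog) {c : Config}
    (hc : ∀ p ∈ c.todo, p.StacksBelow R) (hne : c.todo ≠ []) :
    step (c.embed R m₀ q) = (step c).map (Config.embed R m₀ q) := by
  obtain ⟨k, m, ψ⟩ := c
  cases k with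
  | nil => exact absurd rfl hne
  | cons p k =>
    have hp : p.StacksBelow R := hc p (by simp)
    cases p with
    | branch r p q₀ q₁ =>
      have hr := mergeMem_of_lt hp.1 m₀ m
      rcases h : m r with _ | ⟨_ | _, l⟩ <;> rw [h] at hr <;> simp [step, Config.embed, h, hr]
    | loop r p =>
      have hr := mergeMem_of_lt hp.1 m₀ m
      rcases h : m r with _ | ⟨b, l⟩ <;> rw [h] at hr <;> simp [step, Config.embed, h, hr]
    | cnot r r' | measure r r' =>
      simp only [Prog.StacksBelow] at hp
      simp [step, Config.embed, mergeMem_pushBit hp.2, mergeMem_of_lt hp.1, mergeMem_of_lt hp.2]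
    | _ =>
      simp only [Prog.StacksBelow] at hp
      simp [step, Config.embed, *, mergeMem_update, mergeMem_pushBit, mergeMem_of_lt]

theorem stacksBelow_of_mem_step {R : ℕ} {c d : Config} (hc : ∀ p ∈ c.todo, p.StacksBelow R)
    (hd : d ∈ step c) : ∀ p ∈ d.todo, p.StacksBelow R := by
  obtain ⟨k, m, ψ⟩ := c
  rcases k with _ | ⟨p, k⟩
  · simp [step] at hd
    simp [hd]
  have hp : p.StacksBelow R := hc p (by simp)
  have hk : ∀ p ∈ k, p.StacksBelow R := fun p h => hc p (by simp [h])
  cases p with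
  | branch r p q₀ q₁ =>
    rcases h : m r with _ | ⟨_ | _, l⟩ <;> simp [step, h] at hd <;>
      simp_all [Prog.StacksBelow]
  | loop r p =>
    rcases h : m r with _ | ⟨b, l⟩ <;> simp [step, h] at hd <;> simp_all [Prog.StacksBelow]
  | coin | measure =>
    simp only [step, List.mem_cons, List.not_mem_nil, or_false] at hd
    rcases hd with rfl | rfl <;> exact hk
  | _ =>
    simp [step] at hd
    simp_all [Prog.StacksBelow]

/-- Bounds the length of the output by the running time, and hence the cost of processing it. -/
theorem length_le_of_mem_step {c d : Config} (hd : d ∈ step c) (r : ℕ) :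
    (d.mem r).length ≤ (c.mem r).length + 1 := by
  obtain ⟨k, m, ψ⟩ := c
  have hpush : ∀ s b, (pushBit m s b r).length ≤ (m r).length + 1 := fun s b => by
    by_cases h : r = s
    · subst h
      simp [pushBit]
    · simp [pushBit, h]
  have hpop : ∀ s, (Function.update m s (m s).tail r).length ≤ (m r).length + 1 := fun s => by
    by_cases h : r = s
    · subst h
      simp
      omega
    · simp [h]
  rcases k with _ | ⟨p, k⟩
  · simp [step] at hd
    simp [hd]
  cases p with
  | branch s p q₀ q₁ => rcases h : m s with _ | ⟨_ | _, l⟩ <;> simp [step, h] at hd <;> simp [hd]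
  | loop s p => rcases h : m s with _ | ⟨b, l⟩ <;> simp [step, h] at hd <;> simp [hd]
  | coin | measure =>
    simp only [step, List.mem_cons, List.not_mem_nil, or_false] at hd
    rcases hd with rfl | rfl <;> exact hpush _ _
  | push => simpa [step, List.mem_singleton.1 hd] using hpush _ _
  | pop => simpa [step, List.mem_singleton.1 hd] using hpop _
  | _ =>
    simp [step] at hd
    simp [hd]

/-- If `q` deterministically replaces the output `y` by `g y`, then running `q` after an algorithm
that halts maps its output distribution by `g`. -/
theorem haltsFrom_haltMass_embed {R L u : ℕ} (m₀ : ℕ → List Bool) (q : Prog)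
    (g : List Bool → List Bool)
    (hq : ∀ m, (m 4).length ≤ L → ∃ j ≤ u, ∃ m', Exec q (mergeMem R m₀ m) m' j ∧ m' 4 = g (m 4))
    (t : ℕ) (c : Config) (hc : ∀ p ∈ c.todo, p.StacksBelow R) (hL : (c.mem 4).length + t ≤ L)
    (ht : HaltsFrom c t) :
    HaltsFrom (c.embed R m₀ q) (t + u) ∧
      ∀ E, haltMass E (c.embed R m₀ q) (t + u) = haltMass {y | g y ∈ E} c t := by
  -- A halted branch: `q` finishes in `j ≤ u` steps and the remaining steps are idle, whatever the
  -- value of `t`.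
  have hnil : ∀ (m : ℕ → List Bool) (ψ : QState) (t : ℕ), (m 4).length ≤ L →
      HaltsFrom (Config.embed R m₀ q ⟨[], m, ψ⟩) (t + u) ∧
      ∀ E, haltMass E (Config.embed R m₀ q ⟨[], m, ψ⟩) (t + u) =
        haltMass {y | g y ∈ E} ⟨[], m, ψ⟩ t := by
    intro m ψ t hm
    obtain ⟨j, hj, m', hex, hm'⟩ := hq m hm
    obtain ⟨d, hd⟩ := Nat.exists_eq_add_of_le (hj.trans (Nat.le_add_left u t))
    rw [hd]
    refine ⟨hex.haltsFrom ?_, fun E => (hex.haltMass_eq E [] ψ d).trans ?_⟩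
    · simp [HaltsFrom, branches_of_todo_nil]
    · rw [haltMass_of_todo_nil, haltMass_of_todo_nil, hm']
      rfl
  induction t generalizing c with
  | zero =>
    rcases ht c (by simp [branches]) with h | h
    -- An unfinished branch of weight zero: both masses vanish.
    · exact ⟨haltsFrom_of_state_eq_zero (c := c.embed R m₀ q) h _, fun E => by
        rw [haltMass_of_state_eq_zero _ (show (c.embed R m₀ q).state = 0 from h),
          haltMass_of_state_eq_zero _ h]⟩
    · obtain ⟨k, m, ψ⟩ := c
      obtain rfl : k = [] := h
      exact hnil m ψ 0 (by simpa using hL)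
  | succ t ih =>
    by_cases h : c.todo = []
    · obtain ⟨k, m, ψ⟩ := c
      obtain rfl : k = [] := h
      exact hnil m ψ (t + 1) (le_trans (Nat.le_add_right _ _) hL)
    · have key : ∀ d ∈ step c, HaltsFrom (d.embed R m₀ q) (t + u) ∧
          ∀ E, haltMass E (d.embed R m₀ q) (t + u) = haltMass {y | g y ∈ E} d t := fun d hd =>
        ih d (stacksBelow_of_mem_step hc hd)
          (by have := length_le_of_mem_step hd 4; omega) ((haltsFrom_succ c t).1 ht d hd)
      rw [show t + 1 + u = t + u + 1 by ring]
      constructor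
      · rw [haltsFrom_succ, step_embed m₀ q hc h]
        intro d hd
        obtain ⟨e, he, rfl⟩ := List.mem_map.1 hd
        exact (key e he).1
      · intro E
        rw [haltMass_succ, haltMass_succ, step_embed m₀ q hc h, List.map_map]
        congr 1
        exact List.map_congr_left fun d hd => (key d hd).2 E

/-! ### The evaluation algorithm -/

/-- Put stack `3` aside, run `A`, and form the inner product of its output with the bits that were
on stack `3`.  The stacks `R` and `R + 1` are used as work space. -/
def evalProg (R : ℕ) (A : Prog) : Prog :=
  .seq (.seq (moveProg 3 R) (moveProg R (R + 1))) (.seq A (dotProg R (R + 1)))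

theorem evalProg_spec {R : ℕ} (hR : 4 < R) {A : Prog} (hA : A.StacksBelow R) (x : List Bool)
    (ε δ : ℝ) (s : List Bool) {t : ℕ} (ht : HaltsWithin A x ε δ [] t) :
    HaltsWithin (evalProg R A) x ε δ s (19 * s.length + 3 * t + 11) ∧
      ∀ E, probWithin (evalProg R A) x ε δ s E (19 * s.length + 3 * t + 11) =
        probWithin A x ε δ [] {y | [dotBits y s] ∈ E} t := by
  obtain ⟨m₁, h₁, h3₁, hR₁, ho₁⟩ :=
    exec_moveProg (show 3 ≠ R by omega) s (inputMem x ε δ s) rfl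
  have hR₀ : inputMem x ε δ s R = [] := by
    obtain ⟨n, rfl⟩ := Nat.exists_eq_add_of_lt hR
    rw [show 4 + n + 1 = n + 5 by ring]
    rfl
  rw [hR₀, List.append_nil] at hR₁
  obtain ⟨m₂, h₂, hR₂, hS₂, ho₂⟩ :=
    exec_moveProg (show R ≠ R + 1 by omega) s.reverse m₁ hR₁
  have hS₀ : m₁ (R + 1) = [] := by
    rw [ho₁ _ (by omega) (by omega)]
    obtain ⟨n, rfl⟩ := Nat.exists_eq_add_of_lt hR
    rw [show 4 + n + 1 + 1 = n + 1 + 5 by ring]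
    rfl
  rw [hS₀, List.append_nil, List.reverse_reverse] at hS₂
  rw [List.length_reverse] at h₂
  -- Once stack `3` is empty, the stacks below `R` are exactly the input of `A` without advice. The
  -- two moves reverse `s` twice, so its order is preserved on stack `R + 1`, and `R` is empty
  -- again.
  have hmem : m₂ = mergeMem R m₂ (inputMem x ε δ []) := by
    funext r
    by_cases hr : r < R
    · rw [mergeMem_of_lt hr, ho₂ r (by omega) (by omega)]
      by_cases h3 : r = 3
      · subst h3
        rw [h3₁]
        rfl
      · rw [ho₁ r h3 (by omega)]
        match r, h3 with
        | 0, _ | 1, _ | 2, _ | 3, h => first | rfl | exact absurd rfl h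
        | n + 4, _ => rfl
    · simp [mergeMem, hr]
  have hpost : ∀ m : ℕ → List Bool, (m 4).length ≤ t →
      ∃ j ≤ 9 * s.length + 2 * t + 6, ∃ m', Exec (dotProg R (R + 1)) (mergeMem R m₂ m) m' j ∧
        m' 4 = (fun y => [dotBits y s]) (m 4) := by
    intro m hm
    obtain ⟨n, hn, m', h, h4⟩ := exec_dotProg (a := R) (i := R + 1) (m := mergeMem R m₂ m)
      (by omega) hR (by omega) (by simp [mergeMem, hR₂])
    have h4' : mergeMem R m₂ m 4 = m 4 := mergeMem_of_lt hR _ _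
    have hs' : mergeMem R m₂ m (R + 1) = s := by simp [mergeMem, hS₂]
    rw [h4', hs'] at hn h4
    exact ⟨n, by omega, m', h, h4⟩
  have hsim := haltsFrom_haltMass_embed m₂ (dotProg R (R + 1)) (fun y => [dotBits y s]) hpost t
    (start A x ε δ []) (by simpa [start] using hA) (by simp [start, inputMem]) ht
  have hemb : (start A x ε δ []).embed R m₂ (dotProg R (R + 1)) =
      ⟨[A, dotProg R (R + 1)], m₂, Finsupp.single ∅ 1⟩ := by
    rw [Config.embed]
    simp [start, ← hmem]
  rw [hemb] at hsim
  have hpre : branches (start (evalProg R A) x ε δ s) (10 * s.length + 5) =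
      [⟨[A, dotProg R (R + 1)], m₂, Finsupp.single ∅ 1⟩] := by
    -- One step unfolds the outer `seq`, then come the two moves with their own `seq`, and one more
    -- step unfolds `seq A _`.
    rw [show 10 * s.length + 5 = 1 + ((5 * s.length + 1 + (5 * s.length + 1) + 1) + 1) by ring,
      branches_add _ 1 _]
    simp only [show branches (start (evalProg R A) x ε δ s) 1 =
      [⟨[.seq (moveProg 3 R) (moveProg R (R + 1)), .seq A (dotProg R (R + 1))],
        inputMem x ε δ s, Finsupp.single ∅ 1⟩] from rfl, List.flatMap_singleton]
    rw [branches_add _ (5 * s.length + 1 + (5 * s.length + 1) + 1) 1, (h₁.seq h₂) _ _]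
    rfl
  have htime : 19 * s.length + 3 * t + 11 =
      (10 * s.length + 5) + (t + (9 * s.length + 2 * t + 6)) := by ring
  have hbr : branches (start (evalProg R A) x ε δ s) (19 * s.length + 3 * t + 11) =
      branches ⟨[A, dotProg R (R + 1)], m₂, Finsupp.single ∅ 1⟩
        (t + (9 * s.length + 2 * t + 6)) := by
    rw [htime, branches_add, hpre]
    simp
  constructor
  · rw [HaltsWithin, hbr]
    exact hsim.1
  · intro E
    rw [probWithin, hbr]
    exact hsim.2 E

theorem outProb_evalProg {R : ℕ} (hR : 4 < R) {A : Prog} (hA : A.StacksBelow R) (x : List Bool)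
    (ε δ : ℝ) (s : List Bool) {t : ℕ} (ht : HaltsWithin A x ε δ [] t) (E : Set (List Bool)) :
    outProb (evalProg R A) x ε δ s E = outProb A x ε δ [] {y | [dotBits y s] ∈ E} := by
  -- The two masses agree only at matching times `T ≥ t`. By monotonicity these times suffice for
  -- both suprema.
  have key : ∀ T, t ≤ T → probWithin (evalProg R A) x ε δ s E (19 * s.length + 3 * T + 11) =
      probWithin A x ε δ [] {y | [dotBits y s] ∈ E} T := fun T hT =>
    (evalProg_spec hR hA x ε δ s (HaltsFrom.mono ht hT)).2 E
  refine le_antisymm (iSup_le fun T => ?_) (iSup_le fun T => ?_)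
  · refine le_trans (haltMass_mono E _ (show T ≤ 19 * s.length + 3 * (t + T) + 11 by omega)) ?_
    exact (key (t + T) (by omega)).le.trans
      (le_iSup (fun T => probWithin A x ε δ [] {y | [dotBits y s] ∈ E} T) (t + T))
  · refine le_trans (haltMass_mono _ _ (show T ≤ t + T by omega)) ?_
    exact (key (t + T) (by omega)).ge.trans
      (le_iSup (fun T => probWithin (evalProg R A) x ε δ s E T) _)

theorem realisesEvaluation_evalProg {D : ℕ → ℕ} {R : ℕ} (hR : 4 < R) {A : Prog}
    (hA : A.StacksBelow R) {f : (N : ℕ) → (Fin N → Bool) → (Fin (D N) → ZMod 2)}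
    {𝒟 : (N : ℕ) → PMF (Fin N → Bool)} (h : SolvesHeuristically A f 𝒟) :
    RealisesEvaluation (D := D) (evalProg R A) A 𝒟 := by
  obtain ⟨p, hp⟩ := h
  intro N hN ε δ hε hε' hδ hδ' x hx s E
  obtain ⟨t, -, ht⟩ := (hp N hN ε δ hε hε' hδ hδ').1 x hx
  rw [outProb_evalProg hR hA (bits x) ε δ (vecBits s) ht E]
  simp only [dotBits_vecBits]

theorem efficientlyEvaluates_evalProg {D : ℕ → ℕ} {R : ℕ} (hR : 4 < R) {A : Prog}
    (hA : A.StacksBelow R) {f : (N : ℕ) → (Fin N → Bool) → (Fin (D N) → ZMod 2)}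
    {𝒟 : (N : ℕ) → PMF (Fin N → Bool)} (h : SolvesHeuristically A f 𝒟) :
    EfficientlyEvaluates (evalProg R A) (linearClass f) 𝒟 := by
  have hreal := realisesEvaluation_evalProg hR hA h
  obtain ⟨p, hp⟩ := h
  intro q
  -- The step count of `evalProg_spec`, with `q` bounding the length of `s` and `p` the running time
  -- of `A`.
  refine ⟨19 * q + 3 * p + 11, ?_⟩
  rintro N hN ε δ hε hε' hδ hδ' σ h ⟨s, rfl, rfl⟩ hlen
  obtain ⟨hrun, hprob⟩ := hp N hN ε δ hε hε' hδ hδ'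
  constructor
  · intro x hx
    obtain ⟨t, htp, ht⟩ := hrun x hx
    refine ⟨_, ?_, (evalProg_spec hR hA (bits x) ε δ (vecBits s) ht).1⟩
    have hpoly : polyVal (19 * q + 3 * p + 11) N ε δ =
        19 * polyVal q N ε δ + 3 * polyVal p N ε δ + 11 := by
      simp [polyVal]
    rw [hpoly]
    push_cast
    linarith
  -- The inclusion of events is needed only on the support of `𝒟 N`, where `A` is known to halt and
  -- the output law of `B` is known.
  · refine hprob.trans (PMF.toOuterMeasure_mono _ ?_)
    rintro x ⟨hx, hxs⟩
    change ENNReal.ofReal (1 - δ) ≤ _ at hx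
    change ENNReal.ofReal (1 - δ) ≤ _
    refine hx.trans ?_
    rw [hreal N hN ε δ hε hε' hδ hδ' x hxs s]
    -- The correct output `f_N(x)` of `A` lies in the event that the computed bit equals `h_s(x)`.
    refine iSup_mono fun t => haltMass_subset ?_ _ t
    rintro y rfl
    simp [readVec_vecBits, linearHyp]

end QML

theorem mainTheorem3 (D : ℕ → ℕ)
    (hD : ∃ P : Polynomial ℕ, ∀ N : ℕ, 1 ≤ N → D N ≤ P.eval N)
    (𝒟 : (N : ℕ) → PMF (Fin N → Bool))
    (f : (N : ℕ) → (Fin N → Bool) → (Fin (D N) → ZMod 2)) :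
    (QML.QuantumlyAdvantageous f 𝒟 →
      QML.QuantumlyEfficientlyEvaluatable (QML.linearClass f) 𝒟) ∧
    ∀ A : QML.Prog, QML.SolvesHeuristically A f 𝒟 →
      ∃ B : QML.Prog, QML.RealisesEvaluation (D := D) B A 𝒟 ∧
        QML.EfficientlyEvaluates B (QML.linearClass f) 𝒟 := by
  have key : ∀ A : QML.Prog, QML.SolvesHeuristically A f 𝒟 →
      ∃ B : QML.Prog, QML.RealisesEvaluation (D := D) B A 𝒟 ∧
        QML.EfficientlyEvaluates B (QML.linearClass f) 𝒟 := by
    intro A hA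
    obtain ⟨R, hR⟩ := A.exists_stacksBelow
    -- The shift by 5 keeps the work stacks clear of the input and output stacks `0` to `4`.
    have hR' : A.StacksBelow (R + 5) := hR.mono (Nat.le_add_right R 5)
    exact ⟨QML.evalProg (R + 5) A, QML.realisesEvaluation_evalProg (by omega) hR' hA,
      QML.efficientlyEvaluates_evalProg (by omega) hR' hA⟩
  refine ⟨fun h => ?_, key⟩
  obtain ⟨A, hA⟩ := h.1
  obtain ⟨B, -, hB⟩ := key A hA
  exact ⟨B, hB⟩
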